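/- A metric space is absolutely homogeneous (AB-HO) if every isometry between two arbitrary subsets of it extends to a bijective isometry of the whole space onto itself. For a function $f:(0,\infty)\to\{1,2,3,\ldots\}$ and a point $a=(a_t)_{t>0}\in\prod_{t>0}\{1,\ldots,f(t)\}$, let $P_{f,a}$ be the set of all $x\in\prod_{t>0}\{1,\ldots,f(t)\}$ such that the set $\{t>0: x_t\neq a_t\}$ is well-ordered by the reverse $\geq$ of the natural order (that is, each of its non-empty subsets has a greatest element), equipped with the metric $\rho(x,x)=0$ and $\rho(x,y)=\max\{t>0: x_t\neq y_t\}$ for $x\neq y$. In other words, $P_{f,a}$ is the ordered product, over $t>0$ in the reverse order, of the discrete metric spaces $\{1,\ldots,f(t)\}$ in which distinct points are at distance $t$. (1) Every non-empty AB-HO ultrametric space $Z$ determines a unique function $f:(0,\infty)\to\{1,2,3,\ldots\}$ such that $Z$ is isometric to $P_{f,a}$ for some $a$; moreover, $Z$ is then isometric to $P_{f,a}$ for every $a$. (2) Conversely, every $P_{f,a}$ is a non-empty AB-HO ultrametric space. (3) Consequently, assigning to $f$ the isometry class of $P_{f,a}$ (which does not depend on $a$) is a bijection between the functions $f:(0,\infty)\to\{1,2,3,\ldots\}$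 and the isometry classes of non-empty AB-HO ultrametric spaces. -/

import Mathlib

open OrderDual

universe u

noncomputable section

/-- A metric space is absolutely homogeneous (AB-HO) if every isometry between two arbitrary
subsets of it extends to a (bijective) isometry of the whole space. -/
def AbsolutelyHomogeneous (X : Type*) [MetricSpace X] : Prop :=
  ∀ (A B : Set X) (u : A ≃ᵢ B), ∃ v : X ≃ᵢ X, ∀ a : A, v (a : X) = (u a : X)

section Product

variable {S : Type*} {V : S → Type*}

/-- The set of all indices at which two elements of a product differ. -/
def difSet (x y : ∀ s, V s) : Set S := {s | x s ≠ y s}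

theorem difSet_nonempty {x y : ∀ s, V s} (h : x ≠ y) : (difSet x y).Nonempty :=
  Function.ne_iff.mp h

variable [LinearOrder S]

theorem difSet_isWF {a x y : ∀ s, V s} (hx : (difSet x a).IsWF) (hy : (difSet y a).IsWF) :
    (difSet x y).IsWF := by
  refine (hx.union hy).mono ?_
  intro s hs
  by_contra hc
  simp only [difSet, Set.mem_union, Set.mem_ofPred_eq, not_or, not_not] at hc hs
  exact hs (hc.1.trans hc.2.symm)

/-- The underlying set of the ordered product of a family `V` over a totally ordered set `S`
of indices, with base point `a`: all elements of the full product that differ from `a` on a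
well-ordered set of indices. -/
def OrderedProduct (V : S → Type*) (a : ∀ s, V s) : Type _ :=
  {x : ∀ s, V s // (difSet x a).IsWF}

/-- The least index at which two distinct elements of the ordered product differ. -/
def OrderedProduct.firstDif {a : ∀ s, V s} (x y : OrderedProduct V a) (h : x ≠ y) : S :=
  (difSet_isWF x.2 y.2).min (difSet_nonempty fun e => h (Subtype.ext e))

open Classical in
/-- The distance of distinct elements is the distance of their coordinates at the first index
at which they differ. -/
instance OrderedProduct.instDist [∀ s, Dist (V s)] (a : ∀ s, V s) :
    Dist (OrderedProduct V a) where
  dist x y := if h : x = y then 0 else dist (x.1 (x.firstDif y h)) (y.1 (x.firstDif y h))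

end Product

/-- The set `{1, …, n}` (realised as `Fin n`) with the discrete metric multiplied by `t`. -/
def ScaledDiscrete (_t : Set.Ioi (0 : ℝ)) (n : ℕ+) : Type := Fin (n : ℕ)

open Classical in
instance ScaledDiscrete.instMetricSpace (t : Set.Ioi (0 : ℝ)) (n : ℕ+) :
    MetricSpace (ScaledDiscrete t n) where
  dist i j := if i = j then 0 else (t : ℝ)
  dist_self i := by simp
  dist_comm i j := by simp only [eq_comm]
  dist_triangle i j k := by
    have ht : (0 : ℝ) < t := t.2
    by_cases h1 : i = j <;> by_cases h2 : j = k <;> by_cases h3 : i = k <;>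
      simp_all <;> linarith
  eq_of_dist_eq_zero {i j} h := by
    have ht : (0 : ℝ) < t := t.2
    by_contra hne
    simp only [hne, if_false] at h
    exact ht.ne' h

theorem ScaledDiscrete.dist_of_ne {t : Set.Ioi (0 : ℝ)} {n : ℕ+} {i j : ScaledDiscrete t n}
    (h : i ≠ j) : dist i j = (t : ℝ) := if_neg h

/-- The factors, indexed by the positive reals with the reverse order. -/
abbrev UltraFactor (f : Set.Ioi (0 : ℝ) → ℕ+) (t : (Set.Ioi (0 : ℝ))ᵒᵈ) : Type :=
  ScaledDiscrete (ofDual t) (f (ofDual t))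

/-- The ordered product, over all `t > 0` in the reverse order, of the discrete spaces with `f t`
points scaled by `t`, with base point `a`. -/
def UltraProduct (f : Set.Ioi (0 : ℝ) → ℕ+) (a : ∀ t, UltraFactor f t) : Type :=
  OrderedProduct (UltraFactor f) a

namespace UltraProduct

variable {f : Set.Ioi (0 : ℝ) → ℕ+} {a : ∀ t, UltraFactor f t}

instance instDist : Dist (UltraProduct f a) := OrderedProduct.instDist (V := UltraFactor f) a

theorem dist_of_eq {x y : UltraProduct f a} (h : x = y) : dist x y = 0 := dif_pos h

theorem dist_of_ne {x y : UltraProduct f a} (h : x ≠ y) :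
    dist x y = ((ofDual (OrderedProduct.firstDif (V := UltraFactor f) x y h) :
      Set.Ioi (0 : ℝ)) : ℝ) := by
  refine (dif_neg h).trans (ScaledDiscrete.dist_of_ne ?_)
  exact Set.IsWF.min_mem (difSet_isWF x.2 y.2) _

theorem dist_nonneg' (x y : UltraProduct f a) : 0 ≤ dist x y := by
  by_cases h : x = y
  · exact (dist_of_eq h).ge
  · rw [dist_of_ne h]
    exact le_of_lt (Subtype.prop _)

theorem dist_le_iff {x y : UltraProduct f a} {r : ℝ} (hr : 0 ≤ r) :
    dist x y ≤ r ↔ ∀ t : Set.Ioi (0 : ℝ), r < t → x.1 (toDual t) = y.1 (toDual t) := by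
  by_cases h : x = y
  · rw [dist_of_eq h]
    exact ⟨fun _ t _ => by rw [h], fun _ => hr⟩
  · rw [dist_of_ne h]
    constructor
    · intro hle t ht
      by_contra hne
      have := Set.IsWF.min_le (difSet_isWF x.2 y.2)
        (difSet_nonempty fun e => h (Subtype.ext e)) (a := toDual t) hne
      have h2 : t ≤ ofDual (OrderedProduct.firstDif (V := UltraFactor f) x y h) := this
      have h3 : (t : ℝ) ≤ (ofDual (OrderedProduct.firstDif (V := UltraFactor f) x y h) :
        Set.Ioi (0 : ℝ)) := h2
      linarith
    · intro H
      by_contra hlt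
      exact Set.IsWF.min_mem (difSet_isWF x.2 y.2)
        (difSet_nonempty fun e => h (Subtype.ext e)) (H _ (not_le.mp hlt))

theorem dist_comm' (x y : UltraProduct f a) : dist x y = dist y x := by
  apply le_antisymm
  · exact (dist_le_iff (dist_nonneg' y x)).2 fun t ht =>
      ((dist_le_iff (dist_nonneg' y x)).1 le_rfl t ht).symm
  · exact (dist_le_iff (dist_nonneg' x y)).2 fun t ht =>
      ((dist_le_iff (dist_nonneg' x y)).1 le_rfl t ht).symm

instance instMetricSpace : MetricSpace (UltraProduct f a) where
  dist_self x := dist_of_eq rfl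
  dist_comm := dist_comm'
  dist_triangle x y z := by
    have h1 := dist_nonneg' x y
    have h2 := dist_nonneg' y z
    refine (dist_le_iff (add_nonneg h1 h2)).2 fun t ht => ?_
    exact ((dist_le_iff h1).1 le_rfl t (by linarith)).trans
      ((dist_le_iff h2).1 le_rfl t (by linarith))
  eq_of_dist_eq_zero {x y} h := by
    by_contra hne
    rw [dist_of_ne hne] at h
    exact (Subtype.prop (ofDual (OrderedProduct.firstDif (V := UltraFactor f) x y hne))).ne' h

end UltraProduct

/-- Non-empty AB-HO ultrametric spaces. -/
structure ABHOUltrametricSpace where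
  carrier : Type u
  [metricSpace : MetricSpace carrier]
  [isUltrametricDist : IsUltrametricDist carrier]
  [nonempty : Nonempty carrier]
  absolutelyHomogeneous : AbsolutelyHomogeneous carrier

attribute [instance] ABHOUltrametricSpace.metricSpace

/-- Being isometric, as an equivalence relation on the non-empty AB-HO ultrametric spaces. -/
def isometricSetoid : Setoid ABHOUltrametricSpace.{u} where
  r X Y := Nonempty (X.carrier ≃ᵢ Y.carrier)
  iseqv :=
    { refl := fun X => ⟨IsometryEquiv.refl X.carrier⟩
      symm := fun h => h.map IsometryEquiv.symm
      trans := fun h₁ h₂ => h₁.elim fun e₁ => h₂.map fun e₂ => e₁.trans e₂ }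

end

/-! Two properties characterise the spaces in question. One is the branching function `f`: each
closed ball of radius `t` splits into exactly `f t` open balls of radius `t`. The other is spherical
completeness, `BallsHaveCommonPoint`. If two non-empty ultrametric spaces are spherically complete
with the same branching, any partial isometry between them extends by one more point
(`IsPartialIsometry.exists_dist_eq`). By Zorn it extends to a bijective isometry. Applied to one
space this gives absolute homogeneity, applied to two it gives the classification. The products have
both properties by coordinatewise constructions. An AB-HO space has them because a failure of either
yields an isometry between subsets that cannot extend. Uniqueness of `f` holds because branching is
an isometry invariant. -/

/-! ### Isosceles triangles in ultrametric spaces. -/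

section Ultrametric

variable {X : Type*} [MetricSpace X] [IsUltrametricDist X]

theorem dist_lt_of_dist_lt_of_dist_lt {x y z : X} {t : ℝ} (h₁ : dist x y < t)
    (h₂ : dist y z < t) : dist x z < t :=
  (dist_triangle_max x y z).trans_lt (max_lt h₁ h₂)

theorem dist_le_of_dist_le_of_dist_le {x y z : X} {t : ℝ} (h₁ : dist x y ≤ t)
    (h₂ : dist y z ≤ t) : dist x z ≤ t :=
  (dist_triangle_max x y z).trans (max_le h₁ h₂)

theorem dist_eq_of_dist_lt {x y z : X} (h : dist x y < dist y z) : dist x z = dist y z := by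
  refine le_antisymm (dist_le_of_dist_le_of_dist_le h.le le_rfl) (not_lt.1 fun hlt => ?_)
  rw [dist_comm] at h
  exact (dist_lt_of_dist_lt_of_dist_lt h hlt).false

theorem dist_eq_of_dist_lt_of_dist_lt {x x' y y' : X} {t : ℝ} (hx : dist x' x < t)
    (hy : dist y' y < t) (h : dist x y = t) : dist x' y' = t := by
  have h₁ : dist x' y = t := by rw [dist_eq_of_dist_lt (h.symm ▸ hx), h]
  have h₂ : dist y' x' = dist y x' := dist_eq_of_dist_lt (by rwa [dist_comm y, h₁])
  rw [dist_comm, h₂, dist_comm, h₁]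

end Ultrametric

/-! ### Branching and spherical completeness. -/

/-- Every closed ball of radius `t` is the union of exactly `f t` open balls of radius `t`; the
map `e` picks one point in each of them. -/
def HasBranching (X : Type*) [MetricSpace X] (f : Set.Ioi (0 : ℝ) → ℕ+) : Prop :=
  ∀ (z : X) (t : Set.Ioi (0 : ℝ)), ∃ e : Fin (f t) → X,
    (∀ i, dist (e i) z ≤ t) ∧ (∀ i j, i ≠ j → dist (e i) (e j) = t) ∧
      ∀ y, dist y z ≤ t → ∃ i, dist y (e i) < t

/-- Every family of pairwise intersecting closed balls of an ultrametric space has a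
common point. -/
def BallsHaveCommonPoint (X : Type*) [MetricSpace X] : Prop :=
  ∀ (C : Set X) (r : X → ℝ), (∀ c ∈ C, ∀ c' ∈ C, dist c c' ≤ max (r c) (r c')) →
    ∃ y, ∀ c ∈ C, dist y c ≤ r c

/-- Pigeonhole: points at mutual distance `t` lie in different open balls of radius `t`. -/
theorem HasBranching.card_le {X : Type*} [MetricSpace X] [IsUltrametricDist X]
    {f : Set.Ioi (0 : ℝ) → ℕ+} (h : HasBranching X f) {κ : Type*} [Fintype κ]
    {t : Set.Ioi (0 : ℝ)} (z : X) (g : κ → X) (hg : ∀ k, dist (g k) z ≤ t)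
    (hgt : ∀ k l, k ≠ l → dist (g k) (g l) = t) : Fintype.card κ ≤ f t := by
  obtain ⟨e, -, -, he⟩ := h z t
  choose i hi using fun k => he (g k) (hg k)
  have hinj : Function.Injective i := by
    intro k l hkl
    by_contra hne
    have hl := hi l
    rw [← hkl, dist_comm] at hl
    exact (dist_lt_of_dist_lt_of_dist_lt (hi k) hl).ne (hgt k l hne)
  simpa using Fintype.card_le_of_injective i hinj

theorem HasBranching.le {X : Type*} [MetricSpace X] [IsUltrametricDist X] [Nonempty X]
    {f g : Set.Ioi (0 : ℝ) → ℕ+} (hf : HasBranching X f) (hg : HasBranching X g)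
    (t : Set.Ioi (0 : ℝ)) : f t ≤ g t := by
  obtain ⟨z⟩ := ‹Nonempty X›
  obtain ⟨e, he, het, -⟩ := hf z t
  have := hg.card_le z e he het
  rw [Fintype.card_fin] at this
  exact_mod_cast this

theorem HasBranching.unique {X : Type*} [MetricSpace X] [IsUltrametricDist X] [Nonempty X]
    {f g : Set.Ioi (0 : ℝ) → ℕ+} (hf : HasBranching X f) (hg : HasBranching X g) : f = g :=
  funext fun t => le_antisymm (hf.le hg t) (hg.le hf t)

section Transfer

variable {X Y : Type*} [MetricSpace X] [MetricSpace Y]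

theorem HasBranching.of_isometryEquiv {f : Set.Ioi (0 : ℝ) → ℕ+} (h : HasBranching X f)
    (v : X ≃ᵢ Y) : HasBranching Y f := by
  intro z t
  obtain ⟨e, h₁, h₂, h₃⟩ := h (v.symm z) t
  refine ⟨v ∘ e, fun i => ?_, fun i j hij => ?_, fun y hy => ?_⟩
  · rw [← v.symm.dist_eq]
    simpa using h₁ i
  · simpa [v.dist_eq] using h₂ i j hij
  · obtain ⟨i, hi⟩ := h₃ (v.symm y) (by simpa [v.symm.dist_eq] using hy)
    refine ⟨i, ?_⟩
    rw [← v.symm.dist_eq]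
    simpa using hi

theorem BallsHaveCommonPoint.of_isometryEquiv (h : BallsHaveCommonPoint X) (v : X ≃ᵢ Y) :
    BallsHaveCommonPoint Y := by
  intro C r hC
  obtain ⟨x, hx⟩ := h (v ⁻¹' C) (r ∘ v) fun c hc c' hc' => by
    simpa [v.dist_eq] using hC _ hc _ hc'
  refine ⟨v x, fun c hc => ?_⟩
  have := hx (v.symm c) (by simpa using hc)
  rw [← v.dist_eq] at this
  simpa using this

theorem IsUltrametricDist.of_isometryEquiv [IsUltrametricDist X] (v : X ≃ᵢ Y) :
    IsUltrametricDist Y where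
  dist_triangle_max x y z := by
    simpa only [v.symm.dist_eq] using dist_triangle_max (v.symm x) (v.symm y) (v.symm z)

end Transfer

/-! ### Extending partial isometries. -/

section BackAndForth

variable {X Y : Type*} [MetricSpace X] [MetricSpace Y]

/-- The graph of an isometry between two subsets. -/
def IsPartialIsometry (G : Set (X × Y)) : Prop :=
  ∀ p ∈ G, ∀ q ∈ G, dist p.1 q.1 = dist p.2 q.2

theorem IsPartialIsometry.insert {G : Set (X × Y)} (hG : IsPartialIsometry G) {x : X} {y : Y}
    (h : ∀ p ∈ G, dist x p.1 = dist y p.2) : IsPartialIsometry (insert (x, y) G) := by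
  rintro p (rfl | hp) q (rfl | hq)
  · simp
  · exact h q hq
  · simpa only [dist_comm] using h p hp
  · exact hG p hp q hq

theorem IsPartialIsometry.exists_maximal {G : Set (X × Y)} (hG : IsPartialIsometry G) :
    ∃ M, G ⊆ M ∧ Maximal IsPartialIsometry M := by
  refine zorn_subset_nonempty {G | IsPartialIsometry G} (fun c hc hchain _ => ?_) G hG
  refine ⟨⋃₀ c, ?_, fun s hs => Set.subset_sUnion_of_mem hs⟩
  rintro p ⟨s, hs, hps⟩ q ⟨s', hs', hqs⟩
  rcases hchain.total hs hs' with h | h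
  · exact hc hs' p (h hps) q hqs
  · exact hc hs p hps q (h hqs)

variable [IsUltrametricDist X] [IsUltrametricDist Y] {f : Set.Ioi (0 : ℝ) → ℕ+}

/-- If some point of the domain is nearest to `x`, at distance `t > 0`, counting open `t`-balls
leaves a free one for `y`. If none is nearest, spherical completeness supplies `y`, and ever closer
points of the domain force all its distances. -/
theorem IsPartialIsometry.exists_dist_eq [Nonempty Y] (hX : HasBranching X f)
    (hY : HasBranching Y f) (hY' : BallsHaveCommonPoint Y) {G : Set (X × Y)}
    (hG : IsPartialIsometry G) (x : X) : ∃ y, ∀ p ∈ G, dist x p.1 = dist y p.2 := by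
  by_cases hmin : ∃ p ∈ G, ∀ q ∈ G, dist x p.1 ≤ dist x q.1
  · obtain ⟨p, hp, hpmin⟩ := hmin
    rcases (dist_nonneg (x := x) (y := p.1)).eq_or_lt with h0 | h0
    · exact ⟨p.2, fun q hq => by rw [dist_eq_zero.1 h0.symm, hG p hp q hq]⟩
    · obtain ⟨t, ht⟩ : ∃ t : Set.Ioi (0 : ℝ), (t : ℝ) = dist x p.1 := ⟨⟨_, h0⟩, rfl⟩
      rw [← ht] at hpmin
      obtain ⟨e, he, het, -⟩ := hY p.2 t
      -- If the images of points at distance `t` from `x` met all `f t` open balls, their preimages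
      -- together with `x` would be `f t + 1` points at mutual distance `t`.
      have hfree : ∃ i, ∀ q ∈ G, dist x q.1 = t → ¬ dist (e i) q.2 < t := by
        by_contra! hcon
        choose q hqG hqx hqe using hcon
        have hcard := hX.card_le (κ := Option (Fin (f t))) (t := t) x
          (fun k => k.elim x fun i => (q i).1) (by
            rintro (_ | i)
            · simpa using t.2.le
            · simpa [dist_comm] using (hqx i).le) (by
            rintro (_ | i) (_ | j) hij
            · exact absurd rfl hij
            · exact hqx j
            · exact (dist_comm _ _).trans (hqx i)
            · have hne : i ≠ j := fun h => hij (by rw [h])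
              refine (hG _ (hqG i) _ (hqG j)).trans ?_
              have h₁ := hqe i
              have h₂ := hqe j
              rw [dist_comm] at h₁ h₂
              exact dist_eq_of_dist_lt_of_dist_lt h₁ h₂ (het i j hne))
        simp at hcard
      obtain ⟨i, hi⟩ := hfree
      refine ⟨e i, fun q hq => ?_⟩
      have hpq := hG p hp q hq
      rcases (hpmin q hq).eq_or_lt with h | h
      · rw [← h]
        refine le_antisymm (not_lt.1 (hi q hq h.symm)) ?_
        refine dist_le_of_dist_le_of_dist_le (he i) ?_
        rw [← hpq]
        refine dist_le_of_dist_le_of_dist_le (y := x) ?_ h.ge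
        rw [dist_comm, ht]
      · rw [ht] at h
        have h₁ : dist p.1 q.1 = dist x q.1 := dist_eq_of_dist_lt (by rwa [dist_comm p.1])
        rw [← h₁, hpq]
        refine (dist_eq_of_dist_lt ((he i).trans_lt ?_)).symm
        rwa [← hpq, h₁, ht]
  · push Not at hmin
    classical
    have hsnd : ∀ p ∈ G, ∀ q ∈ G, p.2 = q.2 → p.1 = q.1 := fun p hp q hq h => by
      rw [← dist_eq_zero, hG p hp q hq, h, dist_self]
    -- The radius at `p.2` is the distance from `x` to `p.1`; by `hsnd` the choice of `p` is
    -- immaterial. The value 0 off the range of `G` is never used.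
    let r : Y → ℝ := fun c => if h : ∃ p ∈ G, p.2 = c then dist x h.choose.1 else 0
    have hr : ∀ p ∈ G, r p.2 = dist x p.1 := by
      intro p hp
      have hex : ∃ q ∈ G, q.2 = p.2 := ⟨p, hp, rfl⟩
      refine (dif_pos hex).trans ?_
      rw [hsnd _ hex.choose_spec.1 p hp hex.choose_spec.2]
    have hball : ∀ c ∈ Prod.snd '' G, ∀ c' ∈ Prod.snd '' G, dist c c' ≤ max (r c) (r c') := by
      rintro _ ⟨p, hp, rfl⟩ _ ⟨q, hq, rfl⟩
      rw [hr p hp, hr q hq, ← hG p hp q hq, dist_comm x p.1]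
      exact dist_triangle_max p.1 x q.1
    obtain ⟨y, hy⟩ := hY' _ r hball
    have hle : ∀ p ∈ G, dist y p.2 ≤ dist x p.1 := fun p hp =>
      (hy p.2 ⟨p, hp, rfl⟩).trans (hr p hp).le
    refine ⟨y, fun p hp => ?_⟩
    -- A point `q` closer to `x` than `p` turns the bound `hle` at `q` into equality at `p`.
    obtain ⟨q, hq, hqp⟩ := hmin p hp
    have h₁ : dist q.1 p.1 = dist x p.1 := dist_eq_of_dist_lt (by rwa [dist_comm q.1])
    have h₂ := hG q hq p hp
    rw [← h₁, h₂]
    refine (dist_eq_of_dist_lt ((hle q hq).trans_lt ?_)).symm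
    rwa [← h₂, h₁]

theorem IsPartialIsometry.exists_isometryEquiv [Nonempty X] [Nonempty Y] (hX : HasBranching X f)
    (hX' : BallsHaveCommonPoint X) (hY : HasBranching Y f) (hY' : BallsHaveCommonPoint Y)
    {G : Set (X × Y)} (hG : IsPartialIsometry G) : ∃ v : X ≃ᵢ Y, ∀ p ∈ G, v p.1 = p.2 := by
  obtain ⟨M, hGM, hM⟩ := hG.exists_maximal
  have hMP : IsPartialIsometry M := hM.prop
  have hmem : ∀ x y, (∀ p ∈ M, dist x p.1 = dist y p.2) → (x, y) ∈ M := fun x y h =>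
    hM.le_of_ge (hMP.insert h) (Set.subset_insert _ _) (Set.mem_insert _ _)
  have hdom : ∀ x, ∃ y, (x, y) ∈ M := fun x =>
    (hMP.exists_dist_eq hX hY hY' x).imp fun y => hmem x y
  have hran : ∀ y, ∃ x, (x, y) ∈ M := by
    intro y
    have hswap : IsPartialIsometry (Prod.swap ⁻¹' M) := fun p hp q hq =>
      (hMP p.swap hp q.swap hq).symm
    obtain ⟨x, hx⟩ := hswap.exists_dist_eq hY hX hX' y
    exact ⟨x, hmem x y fun p hp => (hx p.swap (by simpa using hp)).symm⟩
  choose v hv using hdom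
  choose w hw using hran
  have hiso : Isometry v := Isometry.of_dist_eq fun x x' => (hMP _ (hv x) _ (hv x')).symm
  have huniq : ∀ x y, (x, y) ∈ M → v x = y := fun x y h => by
    rw [← dist_eq_zero]
    simpa using (hMP _ (hv x) _ h).symm
  exact ⟨IsometryEquiv.mk' v w (fun y => huniq _ _ (hw y)) hiso,
    fun p hp => huniq p.1 p.2 (hGM hp)⟩

theorem HasBranching.nonempty_isometryEquiv [Nonempty X] [Nonempty Y] (hX : HasBranching X f)
    (hX' : BallsHaveCommonPoint X) (hY : HasBranching Y f) (hY' : BallsHaveCommonPoint Y) :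
    Nonempty (X ≃ᵢ Y) := by
  have hG : IsPartialIsometry (∅ : Set (X × Y)) := fun p hp => hp.elim
  exact (hG.exists_isometryEquiv hX hX' hY hY').nonempty

theorem HasBranching.absolutelyHomogeneous (hX : HasBranching X f)
    (hX' : BallsHaveCommonPoint X) : AbsolutelyHomogeneous X := by
  intro A B u
  rcases isEmpty_or_nonempty X with h | h
  · exact ⟨IsometryEquiv.refl X, fun a => isEmptyElim (a : X)⟩
  · have hG : IsPartialIsometry (Set.range fun a : A => ((a : X), (u a : X))) := by
      rintro _ ⟨a, rfl⟩ _ ⟨b, rfl⟩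
      exact (u.dist_eq a b).symm
    obtain ⟨v, hv⟩ := hG.exists_isometryEquiv hX hX' hX hX'
    exact ⟨v, fun a => hv _ ⟨a, rfl⟩⟩

end BackAndForth

/-! ### Consequences of absolute homogeneity. -/

section Homogeneous

variable {Z : Type*} [MetricSpace Z]

theorem AbsolutelyHomogeneous.exists_isometryEquiv (h : AbsolutelyHomogeneous Z) {ι : Type*}
    (a b : ι → Z) (hab : ∀ i j, dist (a i) (a j) = dist (b i) (b j)) :
    ∃ v : Z ≃ᵢ Z, ∀ i, v (a i) = b i := by
  have key : ∀ {a b : ι → Z}, (∀ i j, dist (a i) (a j) = dist (b i) (b j)) →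
      ∀ (x : Set.range a) (i : ι), a i = x → b x.2.choose = b i := by
    intro a b hab x i hi
    rw [← dist_eq_zero, ← hab, x.2.choose_spec, hi, dist_self]
  let u : Set.range a ≃ᵢ Set.range b := IsometryEquiv.mk'
    (fun x => ⟨b x.2.choose, Set.mem_range_self _⟩)
    (fun y => ⟨a y.2.choose, Set.mem_range_self _⟩)
    (fun y => Subtype.ext ((key hab _ y.2.choose rfl).trans y.2.choose_spec))
    (Isometry.of_dist_eq fun x y => by
      change dist (b _) (b _) = dist (x : Z) y
      rw [← hab, x.2.choose_spec, y.2.choose_spec])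
  obtain ⟨v, hv⟩ := h _ _ u
  exact ⟨v, fun i => (hv ⟨a i, i, rfl⟩).trans (key hab ⟨a i, i, rfl⟩ i rfl)⟩

theorem AbsolutelyHomogeneous.exists_isometryEquiv_apply_eq (h : AbsolutelyHomogeneous Z)
    (x y : Z) : ∃ v : Z ≃ᵢ Z, v x = y := by
  obtain ⟨v, hv⟩ := h.exists_isometryEquiv (fun _ : Unit => x) (fun _ => y) (by simp)
  exact ⟨v, hv ()⟩

variable [IsUltrametricDist Z]

/-- If the balls had no common point, `φ` would act as the distance to an ideal missing point.
Points `b s` with `φ (b s) = s` have the same mutual distances as points `a s` at distance `s` from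
the actual point `x₀`. Extending `b s ↦ a s` and pulling `x₀` back realises the ideal point, which
is absurd. -/
theorem AbsolutelyHomogeneous.ballsHaveCommonPoint [Nonempty Z] (h : AbsolutelyHomogeneous Z) :
    BallsHaveCommonPoint Z := by
  intro C r hC
  by_contra! hcon
  choose c hcC hc using hcon
  obtain ⟨x₀⟩ := ‹Nonempty Z›
  -- the distance to the missing common point
  let φ : Z → ℝ := fun y => dist y (c y)
  -- All balls that miss `y` have their centres at the same distance from `y`, so `φ` does not
  -- depend on the choice of `c`.
  have hφ : ∀ y, ∀ c' ∈ C, r c' < dist y c' → φ y = dist y c' := by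
    intro y c' hc' hlt
    have hle := hC _ (hcC y) _ hc'
    rcases le_total (r (c y)) (r c') with hr | hr
    · rw [max_eq_right hr] at hle
      have := dist_eq_of_dist_lt (x := c y) (y := c') (z := y)
        (by rw [dist_comm c' y]; exact hle.trans_lt hlt)
      rw [dist_comm c' y, dist_comm] at this
      exact this
    · rw [max_eq_left hr, dist_comm] at hle
      have := dist_eq_of_dist_lt (x := c') (y := c y) (z := y)
        (by rw [dist_comm (c y) y]; exact hle.trans_lt (hc y))
      rw [dist_comm (c y) y, dist_comm] at this
      exact this.symm
  have hφ_le : ∀ y z, φ z ≤ max (φ y) (dist z y) := by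
    intro y z
    by_cases hz : r (c y) < dist z (c y)
    · rw [hφ z _ (hcC y) hz, max_comm]
      exact dist_triangle_max _ _ _
    · refine (not_lt.1 fun hlt => ?_)
      have hzy : dist z (c y) < φ y := (not_lt.1 hz).trans_lt (hc y)
      have h₁ : φ y < φ z := (le_max_left _ _).trans_lt hlt
      have h₂ : dist (c y) (c z) = φ z :=
        dist_eq_of_dist_lt (by rw [dist_comm]; exact hzy.trans h₁)
      have h₃ := hC _ (hcC y) _ (hcC z)
      rw [h₂] at h₃
      exact absurd h₃ (not_le.2 (max_lt ((hc y).trans h₁) (hc z)))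
  have hdist : ∀ y z, φ y < φ z → dist y z = φ z := by
    intro y z hlt
    have h₁ : φ z ≤ dist y z := by
      rw [dist_comm]
      exact (le_max_iff.1 (hφ_le y z)).resolve_left (not_le.2 hlt)
    by_cases hz : r (c y) < dist z (c y)
    · refine le_antisymm ?_ h₁
      have h₂ := dist_triangle_max y (c y) z
      rw [dist_comm (c y) z, ← hφ z _ (hcC y) hz] at h₂
      exact h₂.trans (max_le hlt.le le_rfl)
    · refine le_antisymm ?_ h₁
      have h₂ := dist_triangle_max y (c y) z
      rw [dist_comm (c y) z] at h₂
      exact h₂.trans (max_le hlt.le (((not_lt.1 hz).trans (hc y).le).trans hlt.le))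
  have hx₀ : ∀ s : Set.range φ, ∃ a, dist x₀ a = s := by
    rintro ⟨_, y, rfl⟩
    obtain ⟨v, hv⟩ := h.exists_isometryEquiv_apply_eq y x₀
    exact ⟨v (c y), by rw [← hv, v.dist_eq]⟩
  choose a ha using hx₀
  let b : Set.range φ → Z := Set.rangeSplitting φ
  have hb : ∀ s, φ (b s) = s := Set.apply_rangeSplitting φ
  have hlt : ∀ s s' : Set.range φ, (s : ℝ) < s' → dist (b s) (b s') = dist (a s) (a s') := by
    intro s s' hs
    rw [hdist _ _ (by rwa [hb, hb]), hb, ← ha s']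
    refine (dist_eq_of_dist_lt ?_).symm
    rwa [dist_comm, ha, ha]
  obtain ⟨v, hv⟩ := h.exists_isometryEquiv b a fun s s' => by
    rcases lt_trichotomy (s : ℝ) s' with hs | hs | hs
    · exact hlt s s' hs
    · rw [Subtype.ext hs, dist_self, dist_self]
    · rw [dist_comm, hlt s' s hs, dist_comm]
  set w := v.symm x₀ with hw
  have hwb : ∀ s, dist w (b s) = s := fun s => by
    rw [hw, ← v.dist_eq, hv, v.apply_symm_apply, ha]
  have hcw : φ (c w) < φ w := by
    refine lt_of_le_of_lt ?_ (hc w)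
    exact (le_max_iff.1 (hC _ (hcC w) _ (hcC (c w)))).resolve_right (not_le.2 (hc (c w)))
  -- With `s = φ (c w)`, both `φ (b s)` and `dist w (b s)` equal `s`, hence `φ w ≤ s`, against
  -- `hcw`.
  have hcontra := hφ_le (b ⟨φ (c w), c w, rfl⟩) w
  rw [hwb, hb, max_self] at hcontra
  exact absurd hcw (not_lt.2 hcontra)

/-- The open balls of radius `t` in the closed ball of radius `t` about `z`. -/
def openBallSetoid (z : Z) (t : Set.Ioi (0 : ℝ)) : Setoid {y : Z // dist y z ≤ t} where
  r x y := dist (x : Z) y < t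
  iseqv :=
    { refl := fun x => (dist_self (x : Z)).trans_lt t.2
      symm := fun h => by rwa [dist_comm]
      trans := fun h₁ h₂ => dist_lt_of_dist_lt_of_dist_lt h₁ h₂ }

/-- A point in an open ball. -/
noncomputable def openBallPoint {z : Z} {t : Set.Ioi (0 : ℝ)} (q : Quotient (openBallSetoid z t)) : Z :=
  q.out

theorem dist_openBallPoint_le {z : Z} {t : Set.Ioi (0 : ℝ)}
    (q : Quotient (openBallSetoid z t)) : dist (openBallPoint q) z ≤ t :=
  q.out.2

theorem dist_openBallPoint {z : Z} {t : Set.Ioi (0 : ℝ)}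
    (p q : Quotient (openBallSetoid z t)) (h : p ≠ q) :
    dist (openBallPoint p) (openBallPoint q) = t := by
  refine le_antisymm (dist_le_of_dist_le_of_dist_le p.out.2 ?_) (not_lt.1 fun hlt => h ?_)
  · rw [dist_comm]
    exact q.out.2
  · rw [← p.out_eq, ← q.out_eq]
    exact Quotient.sound hlt

theorem exists_dist_openBallPoint_lt {z : Z} {t : Set.Ioi (0 : ℝ)} {y : Z} (hy : dist y z ≤ t) :
    ∃ q : Quotient (openBallSetoid z t), dist y (openBallPoint q) < t := by
  refine ⟨Quotient.mk _ ⟨y, hy⟩, ?_⟩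
  rw [dist_comm]
  exact Quotient.mk_out (s := openBallSetoid z t) ⟨y, hy⟩

/-- Hilbert's hotel: infinitely many open balls could be shifted into themselves, missing one. An
extension of this isometry of representatives preserves the closed ball, so it would have to reach
the missed ball too. -/
theorem AbsolutelyHomogeneous.finite_openBalls (h : AbsolutelyHomogeneous Z) (z : Z)
    (t : Set.Ioi (0 : ℝ)) : Finite (Quotient (openBallSetoid z t)) := by
  by_contra hinf
  rw [not_finite_iff_infinite] at hinf
  obtain ⟨σ⟩ : Nonempty (Option (Quotient (openBallSetoid z t)) ≃ Quotient (openBallSetoid z t)) :=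
    Cardinal.eq.1 (by rw [Cardinal.mk_option, Cardinal.add_one_eq (Cardinal.aleph0_le_mk _)])
  have hσ : ∀ p q, p ≠ q → σ (some p) ≠ σ (some q) := fun p q hpq h =>
    hpq (Option.some_injective _ (σ.injective h))
  obtain ⟨v, hv⟩ := h.exists_isometryEquiv openBallPoint (fun q => openBallPoint (σ (some q)))
    fun p q => by
      by_cases hpq : p = q
      · simp [hpq]
      · rw [dist_openBallPoint p q hpq, dist_openBallPoint _ _ (hσ p q hpq)]
  let y : Z := openBallPoint (σ none)
  have hvz : dist (v z) z ≤ t := by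
    refine dist_le_of_dist_le_of_dist_le ?_ (dist_openBallPoint_le (σ (some (σ none))))
    rw [← hv, v.dist_eq, dist_comm]
    exact dist_openBallPoint_le _
  have hy : dist (v.symm y) z ≤ t := by
    rw [← v.dist_eq, v.apply_symm_apply]
    refine dist_le_of_dist_le_of_dist_le (dist_openBallPoint_le (σ none)) ?_
    rwa [dist_comm]
  obtain ⟨q, hq⟩ := exists_dist_openBallPoint_lt hy
  rw [← v.dist_eq, v.apply_symm_apply, hv] at hq
  exact hq.ne (dist_openBallPoint _ _ fun h => by simpa using σ.injective h)

theorem AbsolutelyHomogeneous.exists_hasBranching [Nonempty Z] (h : AbsolutelyHomogeneous Z) :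
    ∃ f, HasBranching Z f := by
  obtain ⟨z₀⟩ := ‹Nonempty Z›
  have hfin : ∀ t, Finite (Quotient (openBallSetoid z₀ t)) := h.finite_openBalls z₀
  have hne : ∀ t : Set.Ioi (0 : ℝ), Nonempty (Quotient (openBallSetoid z₀ t)) := fun t =>
    ⟨Quotient.mk _ ⟨z₀, by simpa using t.2.le⟩⟩
  refine ⟨fun t => ⟨Nat.card (Quotient (openBallSetoid z₀ t)), Nat.card_pos⟩, fun z t => ?_⟩
  obtain ⟨v, rfl⟩ := h.exists_isometryEquiv_apply_eq z₀ z
  let ε : Fin (Nat.card (Quotient (openBallSetoid z₀ t))) ≃ Quotient (openBallSetoid z₀ t) :=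
    (Finite.equivFin _).symm
  refine ⟨fun i => v (openBallPoint (ε i)), fun i => ?_, fun i j hij => ?_, fun y hy => ?_⟩
  · rw [v.dist_eq]
    exact dist_openBallPoint_le _
  · rw [v.dist_eq]
    exact dist_openBallPoint _ _ (ε.injective.ne hij)
  · rw [← v.symm.dist_eq, v.symm_apply_apply] at hy
    obtain ⟨q, hq⟩ := exists_dist_openBallPoint_lt hy
    refine ⟨ε.symm q, ?_⟩
    rw [← v.symm.dist_eq]
    simpa using hq

end Homogeneous

/-! ### Branching and spherical completeness of the products. -/

namespace UltraProduct

variable {f : Set.Ioi (0 : ℝ) → ℕ+} {a : ∀ t, UltraFactor f t}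

instance instNonempty : Nonempty (UltraProduct f a) :=
  ⟨⟨a, by simp [difSet]⟩⟩

instance instIsUltrametricDist : IsUltrametricDist (UltraProduct f a) where
  dist_triangle_max _ _ _ :=
    (dist_le_iff (le_max_of_le_left dist_nonneg)).2 fun t ht =>
      ((dist_le_iff dist_nonneg).1 le_rfl t ((le_max_left _ _).trans_lt ht)).trans
        ((dist_le_iff dist_nonneg).1 le_rfl t ((le_max_right _ _).trans_lt ht))

theorem ballsHaveCommonPoint : BallsHaveCommonPoint (UltraProduct f a) := by
  classical
  intro C r hC
  have hr : ∀ c ∈ C, 0 ≤ r c := fun c hc => by simpa using hC c hc c hc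
  -- Centres of balls of radius below `t` agree at coordinate `t`, so any of them may be used; where
  -- there is none, the base point keeps the difference set small.
  let y : ∀ t, UltraFactor f t := fun t =>
    if h : ∃ c ∈ C, r c < ofDual t then h.choose.1 t else a t
  have hy : ∀ c ∈ C, ∀ t : Set.Ioi (0 : ℝ), r c < t → y (toDual t) = c.1 (toDual t) := by
    intro c hc t ht
    have hex : ∃ c ∈ C, r c < ofDual (toDual t) := ⟨c, hc, ht⟩
    refine (dif_pos hex).trans ?_
    refine (dist_le_iff dist_nonneg).1 le_rfl t ?_
    exact (hC _ hex.choose_spec.1 c hc).trans_lt (max_lt hex.choose_spec.2 ht)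
  have hyWF : (difSet y a).IsWF := by
    rw [Set.isWF_iff_no_descending_seq]
    intro g hg hmem
    -- A descending sequence in the dual order has increasing real values, so from `g 0` on `y`
    -- agrees with a single `c`, whose difference set is well-founded.
    have h0 : ∃ c ∈ C, r c < ofDual (g 0) := by
      by_contra hcon
      exact hmem 0 (dif_neg hcon)
    obtain ⟨c, hc, hrc⟩ := h0
    refine Set.isWF_iff_no_descending_seq.1 c.2 g hg fun n hn => hmem n ?_
    have hn0 : ofDual (g 0) ≤ ofDual (g n) := hg.antitone (Nat.zero_le n)
    rw [← hn]
    exact hy c hc (ofDual (g n)) (hrc.trans_le hn0)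
  exact ⟨⟨y, hyWF⟩, fun c hc => (dist_le_iff (hr c hc)).2 fun t ht => hy c hc t ht⟩

theorem hasBranching : HasBranching (UltraProduct f a) f := by
  classical
  intro z t
  -- The open balls of radius `t` are told apart by coordinate `t`, the only one changed here.
  let e : Fin (f t) → UltraProduct f a := fun i =>
    ⟨Function.update z.1 (toDual t) i, (z.2.insert (toDual t)).mono fun s hs => by
      by_cases hst : s = toDual t
      · exact Or.inl hst
      · right
        exact fun h => hs ((Function.update_of_ne hst _ _).trans h)⟩
  have he_same : ∀ i, (e i).1 (toDual t) = i := fun i => Function.update_self _ _ _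
  have he : ∀ i, ∀ s : Set.Ioi (0 : ℝ), s ≠ t → (e i).1 (toDual s) = z.1 (toDual s) :=
    fun i s hs => Function.update_of_ne hs _ _
  refine ⟨e, fun i => ?_, fun i j hij => ?_, fun y hy => ⟨y.1 (toDual t), ?_⟩⟩
  · exact (dist_le_iff t.2.le).2 fun s hs => he i s fun h => hs.ne' (by rw [h])
  · refine le_antisymm ((dist_le_iff t.2.le).2 fun s hs => ?_) (not_lt.1 fun hlt => hij ?_)
    · have hst : s ≠ t := fun h => hs.ne' (by rw [h])
      rw [he i s hst, he j s hst]
    · rw [← he_same i, ← he_same j]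
      exact (dist_le_iff dist_nonneg).1 le_rfl t hlt
  · by_cases hye : y = e (y.1 (toDual t))
    · rw [← hye, dist_self]
      exact t.2
    · rw [dist_of_ne hye]
      set s := ofDual (OrderedProduct.firstDif (V := UltraFactor f) y _ hye)
      have hdif : y.1 (toDual s) ≠ (e (y.1 (toDual t))).1 (toDual s) :=
        Set.IsWF.min_mem (difSet_isWF y.2 (e (y.1 (toDual t))).2)
          (difSet_nonempty fun h => hye (Subtype.ext h))
      have hst : s ≠ t := by
        intro hst
        rw [hst] at hdif
        exact hdif (he_same _).symm
      refine lt_of_le_of_ne (not_lt.1 fun hlt => hdif ?_) fun h => hst (Subtype.ext h)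
      exact ((dist_le_iff t.2.le).1 hy s hlt).trans (he _ s hst).symm

/-- The product as an object of an arbitrary universe. -/
noncomputable def toABHO (f : Set.Ioi (0 : ℝ) → ℕ+) (a : ∀ t, UltraFactor f t) :
    ABHOUltrametricSpace.{u} :=
  let v : UltraProduct f a ≃ᵢ ULift.{u} (UltraProduct f a) :=
    ⟨Equiv.ulift.symm, Isometry.of_dist_eq fun _ _ => rfl⟩
  haveI : IsUltrametricDist (ULift.{u} (UltraProduct f a)) := .of_isometryEquiv v
  { carrier := ULift.{u} (UltraProduct f a)
    absolutelyHomogeneous := (hasBranching.of_isometryEquiv v).absolutelyHomogeneous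
      (ballsHaveCommonPoint.of_isometryEquiv v) }

/-- The object `toABHO f a` is isometric to the product. -/
noncomputable def isometryEquivToABHO (f : Set.Ioi (0 : ℝ) → ℕ+) (a : ∀ t, UltraFactor f t) :
    UltraProduct f a ≃ᵢ (toABHO.{u} f a).carrier :=
  ⟨Equiv.ulift.symm, Isometry.of_dist_eq fun _ _ => rfl⟩

theorem nonempty_isometryEquiv (a b : ∀ t, UltraFactor f t) :
    Nonempty (UltraProduct f a ≃ᵢ UltraProduct f b) :=
  hasBranching.nonempty_isometryEquiv ballsHaveCommonPoint hasBranching ballsHaveCommonPoint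

theorem eq_of_isometryEquiv {g : Set.Ioi (0 : ℝ) → ℕ+} {b : ∀ t, UltraFactor g t}
    (v : UltraProduct f a ≃ᵢ UltraProduct g b) : f = g :=
  (hasBranching.of_isometryEquiv v).unique hasBranching

/-- The constant point of the full product. -/
def basePoint (f : Set.Ioi (0 : ℝ) → ℕ+) : ∀ t, UltraFactor f t :=
  fun t => (⟨0, (f (ofDual t)).pos⟩ : Fin (f (ofDual t)))

end UltraProduct

/-! ### The classification. -/

theorem AbsolutelyHomogeneous.exists_isometryEquiv_ultraProduct {Z : Type*} [MetricSpace Z]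
    [IsUltrametricDist Z] [Nonempty Z] (h : AbsolutelyHomogeneous Z) :
    ∃ f : Set.Ioi (0 : ℝ) → ℕ+, ∀ a : ∀ t, UltraFactor f t, Nonempty (Z ≃ᵢ UltraProduct f a) := by
  obtain ⟨f, hf⟩ := h.exists_hasBranching
  exact ⟨f, fun a => hf.nonempty_isometryEquiv h.ballsHaveCommonPoint
    UltraProduct.hasBranching UltraProduct.ballsHaveCommonPoint⟩

theorem mainTheorem6 :
    -- the correspondence between functions and isometry classes is a bijection
    (∃ Φ : (Set.Ioi (0 : ℝ) → ℕ+) ≃ Quotient isometricSetoid.{u},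
      ∀ (f : Set.Ioi (0 : ℝ) → ℕ+) (a : ∀ t, UltraFactor f t) (X : ABHOUltrametricSpace.{u}),
        Φ f = Quotient.mk isometricSetoid X ↔ Nonempty (X.carrier ≃ᵢ UltraProduct f a)) ∧
    -- each space is isometric to a product, with a uniquely determined function
    (∀ (Z : Type u) [MetricSpace Z] [IsUltrametricDist Z] [Nonempty Z],
      AbsolutelyHomogeneous Z →
        ∃ f : Set.Ioi (0 : ℝ) → ℕ+,
          (∀ a : ∀ t, UltraFactor f t, Nonempty (Z ≃ᵢ UltraProduct f a)) ∧
          ∀ (g : Set.Ioi (0 : ℝ) → ℕ+) (b : ∀ t, UltraFactor g t),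
            Nonempty (Z ≃ᵢ UltraProduct g b) → g = f) ∧
    -- each product is a non-empty AB-HO ultrametric space
    (∀ (f : Set.Ioi (0 : ℝ) → ℕ+) (a : ∀ t, UltraFactor f t),
      Nonempty (UltraProduct f a) ∧ IsUltrametricDist (UltraProduct f a) ∧
        AbsolutelyHomogeneous (UltraProduct f a)) := by
  refine ⟨?_, fun Z _ _ _ hZ => ?_, fun f a => ⟨inferInstance, inferInstance,
    UltraProduct.hasBranching.absolutelyHomogeneous UltraProduct.ballsHaveCommonPoint⟩⟩
  · let Φ : (Set.Ioi (0 : ℝ) → ℕ+) → Quotient isometricSetoid.{u} := fun f =>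
      Quotient.mk _ (UltraProduct.toABHO f (UltraProduct.basePoint f))
    have hΦ : ∀ (f : Set.Ioi (0 : ℝ) → ℕ+) (a : ∀ t, UltraFactor f t)
        (X : ABHOUltrametricSpace.{u}),
        Φ f = Quotient.mk isometricSetoid X ↔ Nonempty (X.carrier ≃ᵢ UltraProduct f a) := by
      intro f a X
      obtain ⟨w⟩ := UltraProduct.nonempty_isometryEquiv (UltraProduct.basePoint f) a
      have w' := UltraProduct.isometryEquivToABHO.{u} f (UltraProduct.basePoint f)
      refine Quotient.eq.trans ⟨?_, ?_⟩
      · rintro ⟨v⟩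
        exact ⟨v.symm.trans (w'.symm.trans w)⟩
      · rintro ⟨v⟩
        exact ⟨w'.symm.trans (w.trans v.symm)⟩
    refine ⟨Equiv.ofBijective Φ ⟨fun f g hfg => ?_, fun q => ?_⟩, hΦ⟩
    · obtain ⟨v⟩ := (hΦ f (UltraProduct.basePoint f) _).1 hfg
      have w := UltraProduct.isometryEquivToABHO.{u} g (UltraProduct.basePoint g)
      exact (UltraProduct.eq_of_isometryEquiv (w.trans v)).symm
    · induction q using Quotient.inductionOn with
      | h X =>
        have := X.isUltrametricDist
        have := X.nonempty
        obtain ⟨f, hf⟩ := X.absolutelyHomogeneous.exists_isometryEquiv_ultraProduct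
        exact ⟨f, (hΦ f (UltraProduct.basePoint f) X).2 (hf _)⟩
  · obtain ⟨f, hf⟩ := hZ.exists_isometryEquiv_ultraProduct
    refine ⟨f, hf, fun g b ⟨v⟩ => ?_⟩
    obtain ⟨w⟩ := hf (UltraProduct.basePoint f)
    exact UltraProduct.eq_of_isometryEquiv (v.symm.trans w)
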